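/- Let $K$ be a number field with ring of integers $\mathcal O_K$, let $S$ be a finite set of nonzero prime ideals of $\mathcal O_K$, and let $T\subseteq\mathcal O_K$ be a nonempty set defined by congruence conditions at $S$: there are exponents $e_{\mathfrak p}\ge 0$ $(\mathfrak p\in S)$ such that whether $b\in T$ depends only on the residues of $b$ modulo $\mathfrak p^{e_{\mathfrak p}}$, $\mathfrak p\in S$. Let $k\ge 0$, let $c_1,\dots,c_k,d_1,\dots,d_k\in\mathcal O_K$, and put $A(x)=\prod_{i=1}^k(c_ix+d_i)$. Suppose that $A(x)$ is squarefree as a polynomial in $K[x]$. For a nonzero prime $\mathfrak p$ of $\mathcal O_K$ let \[ a(\mathfrak p)=\frac{\#\{b\in\mathcal O_K/\mathfrak p^2 : A(b)\not\equiv 0 \pmod{\mathfrak p^2}\}}{\#(\mathcal O_K/\mathfrak p^2)} . \] Call $a\in\mathcal O_K$ squarefree away from $S$ if $\mathfrak p^2\nmid (a)$ for every nonzero prime $\mathfrak p\notin S$. Let $q\in\{1,2\}$, and for $b\in K$ put $|b|=\sqrt{\sum_{\sigma}|\sigma(b)|^q}$, where $\sigma$ runs over all embeddings $K\to\mathbb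 C$. Then the product $\prod_{\mathfrak p\notin S}a(\mathfrak p)$ converges unconditionally (possibly to $0$), and, for real $N$, \[ \lim_{N\to\infty}\frac{\#\{b\in T : |b|\le N \text{ and } A(b)\text{ is squarefree away from } S\}}{\#\{b\in T : |b|\le N\}}=\prod_{\mathfrak p\notin S}a(\mathfrak p). \] If moreover $a(\mathfrak p)>0$ for all $\mathfrak p\notin S$, then $\prod_{\mathfrak p\notin S}a(\mathfrak p)>0$. -/

import Mathlib

/-! The integers of bounded size are the points of a lattice in a growing ball, so they are
equidistributed modulo every nonzero ideal. By the Chinese remainder theorem, imposing the condition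
at finitely many primes `𝔭 ∉ S` therefore multiplies the density of `T` by `∏ a(𝔭)`.

What remains is a bound, uniform in the size, for the proportion of `b` with `A(b) ∈ 𝔭²` for some
large prime `𝔭`. The linear forms are pairwise coprime modulo almost all `𝔭`, so that `𝔭²` has to
contain the value of a single form `cb + d`. Nonzero elements of an ideal `J` have norm at least
`N(J)`, hence size `≫ N(J) ^ (1/n)`, where `n = [K : ℚ]`; the `b` with `0 ≠ cb + d ∈ J` are thus so
well separated that their proportion is `O(1 / N(J))`. For `J = 𝔭²` these bounds are summable over
`𝔭`, because at most `n` primes lie over each rational prime. The same bounds give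
`∑ (1 - a(𝔭)) < ∞`, hence the convergence and the positivity of the product. -/

open Filter Topology Polynomial NumberField IsDedekindDomain

noncomputable section

namespace SquarefreeSieve

variable {K : Type*} [Field K] [NumberField K]

/-- `T` is defined by congruence conditions at the finite set `S` of primes: for suitable exponents,
membership of `b` in `T` depends only on the residues of `b` modulo the powers `p ^ e p`, `p ∈ S`. -/
def DefinedByCongruencesAt (S : Finset (HeightOneSpectrum (𝓞 K))) (T : Set (𝓞 K)) : Prop :=
  ∃ e : HeightOneSpectrum (𝓞 K) → ℕ, ∀ b b' : 𝓞 K,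
    (∀ p ∈ S, b - b' ∈ p.asIdeal ^ e p) → (b ∈ T ↔ b' ∈ T)

/-- The polynomial `A(x) = ∏ i, (c i * x + d i)`. -/
def prodLinear {k : ℕ} (c d : Fin k → 𝓞 K) : (𝓞 K)[X] :=
  ∏ i, (C (c i) * X + C (d i))

/-- `a ∈ 𝓞 K` is squarefree away from `S`: no prime `p ∉ S` has `p ^ 2` dividing the ideal `(a)`.
In particular `0` is not squarefree away from `S`. -/
def SquarefreeAway (S : Finset (HeightOneSpectrum (𝓞 K))) (a : 𝓞 K) : Prop :=
  ∀ p : HeightOneSpectrum (𝓞 K), p ∉ S → ¬ p.asIdeal ^ 2 ∣ Ideal.span {a}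

/-- The proportion of residue classes `b` modulo `p ^ 2` with `A(b) ≢ 0` modulo `p ^ 2`. -/
def localDensity (A : (𝓞 K)[X]) (p : HeightOneSpectrum (𝓞 K)) : ℝ :=
  (Nat.card {b : 𝓞 K ⧸ p.asIdeal ^ 2 //
      (A.map (Ideal.Quotient.mk (p.asIdeal ^ 2))).eval b ≠ 0} : ℝ) /
    (Nat.card (𝓞 K ⧸ p.asIdeal ^ 2) : ℝ)

/-- The size `√(∑ σ, |σ b| ^ q)`, the sum running over all embeddings of `K` into `ℂ`. -/
def size (q : ℕ) (b : K) : ℝ :=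
  Real.sqrt (∑ σ : K →+* ℂ, ‖σ b‖ ^ q)

/-- Only finitely many integers have bounded size, so that counting them is meaningful. -/
theorem finite_size_le {q : ℕ} (hq : q ≠ 0) (N : ℝ) :
    {b : 𝓞 K | size q (b : K) ≤ N}.Finite := by
  have h := NumberField.Embeddings.finite_of_norm_le K ℂ (max 1 (N ^ 2))
  refine Set.Finite.of_finite_image (f := fun b : 𝓞 K => (b : K)) (h.subset ?_)
    (RingOfIntegers.coe_injective.injOn)
  rintro _ ⟨b, hb, rfl⟩
  refine ⟨b.isIntegral_coe, fun σ => ?_⟩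
  have hN : (0 : ℝ) ≤ N := (Real.sqrt_nonneg _).trans hb
  have h1 : ∑ τ : K →+* ℂ, ‖τ (b : K)‖ ^ q ≤ N ^ 2 := (Real.sqrt_le_left hN).1 hb
  have h2 : ‖σ (b : K)‖ ^ q ≤ N ^ 2 :=
    (Finset.single_le_sum (f := fun τ : K →+* ℂ => ‖τ (b : K)‖ ^ q)
      (fun _ _ => by positivity) (Finset.mem_univ σ)).trans h1
  by_cases h3 : ‖σ (b : K)‖ ≤ 1
  · exact h3.trans (le_max_left _ _)
  · exact ((le_self_pow₀ (not_le.1 h3).le hq).trans h2).trans (le_max_right _ _)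

end SquarefreeSieve

end

noncomputable section

namespace SquarefreeSieve

section Density

variable {G : Type*} {h : G → ℝ} {X Y : Set G}

/-- The proportion of the points of height at most `R` that lie in `X`. -/
def proportion (h : G → ℝ) (X : Set G) (R : ℝ) : ℝ :=
  ((X ∩ {b | h b ≤ R}).ncard : ℝ) / ({b | h b ≤ R} : Set G).ncard

/-- The set `X` has asymptotic density `δ` when points are counted by increasing height `h`. -/
def HasDensity (h : G → ℝ) (X : Set G) (δ : ℝ) : Prop :=
  Tendsto (proportion h X) atTop (𝓝 δ)

theorem proportion_nonneg (h : G → ℝ) (X : Set G) (R : ℝ) : 0 ≤ proportion h X R := by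
  unfold proportion; positivity

theorem HasDensity.nonneg {δ : ℝ} (hX : HasDensity h X δ) : 0 ≤ δ :=
  ge_of_tendsto' hX (proportion_nonneg h X)

theorem proportion_union_le (h : G → ℝ) (X Y : Set G) (R : ℝ) :
    proportion h (X ∪ Y) R ≤ proportion h X R + proportion h Y R := by
  unfold proportion
  rw [← add_div, Set.union_inter_distrib_right]
  gcongr
  exact_mod_cast Set.ncard_union_le _ _

variable [Northcott h]

theorem proportion_mono (hXY : X ⊆ Y) (R : ℝ) : proportion h X R ≤ proportion h Y R := by
  unfold proportion
  gcongr
  exact (Northcott.finite_le R).inter_of_right Y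

theorem proportion_union (hXY : Disjoint X Y) (R : ℝ) :
    proportion h (X ∪ Y) R = proportion h X R + proportion h Y R := by
  have hfin : {b | h b ≤ R}.Finite := Northcott.finite_le R
  rw [proportion, Set.union_inter_distrib_right, Set.ncard_union_eq
    (hXY.mono Set.inter_subset_left Set.inter_subset_left)
    (hfin.inter_of_right X) (hfin.inter_of_right Y), Nat.cast_add, add_div]
  rfl

theorem proportion_iUnion_le_tsum {ι : Type*} {X : ι → Set G} {u : ι → ℝ} (hu : Summable u)
    {R : ℝ} (hXu : ∀ i, proportion h (X i) R ≤ u i) :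
    proportion h (⋃ i, X i) R ≤ ∑' i, u i := by
  have hfin : ((⋃ i, X i) ∩ {b | h b ≤ R}).Finite := (Northcott.finite_le R).inter_of_right _
  obtain ⟨s, hs, hcover⟩ := Set.finite_subset_iUnion hfin Set.inter_subset_left
  have hbiUnion : proportion h (⋃ i ∈ s, X i) R ≤ ∑ i ∈ hs.toFinset, proportion h (X i) R := by
    unfold proportion
    rw [← Finset.sum_div, ← Nat.cast_sum, Set.iUnion₂_inter]
    gcongr
    simpa using Finset.set_ncard_biUnion_le hs.toFinset fun i => X i ∩ {b | h b ≤ R}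
  calc proportion h (⋃ i, X i) R = proportion h ((⋃ i, X i) ∩ {b | h b ≤ R}) R := by
        simp only [proportion, Set.inter_assoc, Set.inter_self]
    _ ≤ proportion h (⋃ i ∈ s, X i) R := proportion_mono hcover R
    _ ≤ ∑ i ∈ hs.toFinset, proportion h (X i) R := hbiUnion
    _ ≤ ∑ i ∈ hs.toFinset, u i := Finset.sum_le_sum fun i _ => hXu i
    _ ≤ ∑' i, u i := hu.sum_le_tsum _ fun i _ => (proportion_nonneg h _ R).trans (hXu i)

end Density

section Growth

variable {G : Type*} {h : G → ℝ} {n : ℕ}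

/-- The number of points of height at most `R` is asymptotic to a positive multiple of `R ^ n`.
Since `Set.ncard` is `0` on infinite sets, this entails that there are finitely many of them. -/
def HasGrowth (h : G → ℝ) (n : ℕ) : Prop :=
  ∃ V : ℝ, 0 < V ∧
    Tendsto (fun R : ℝ => (({b | h b ≤ R} : Set G).ncard : ℝ) / R ^ n) atTop (𝓝 V)

namespace HasGrowth

theorem northcott (hh : HasGrowth h n) : Northcott h := by
  obtain ⟨V, hV, hlim⟩ := hh
  refine ⟨fun R => ?_⟩
  obtain ⟨R', hpos, hRR'⟩ := ((hlim.eventually_const_lt hV).and (eventually_ge_atTop R)).exists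
  have hcard : ({b | h b ≤ R'} : Set G).ncard ≠ 0 := fun h0 => by simp [h0] at hpos
  exact (Set.finite_of_ncard_ne_zero hcard).subset fun b hb => le_trans hb hRR'

theorem exists_mul_pow_le_ncard (hh : HasGrowth h n) {a : G} (ha : h a ≤ 0) :
    ∃ κ : ℝ, 0 < κ ∧ ∀ R : ℝ, 0 ≤ R → κ * R ^ n ≤ ({b | h b ≤ R} : Set G).ncard := by
  have := hh.northcott
  obtain ⟨V, hV, hlim⟩ := hh
  obtain ⟨R₀, hR₀⟩ := eventually_atTop.1 (hlim.eventually_const_le (half_lt_self hV))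
  set M := max R₀ 1
  have hM : 0 < M := lt_max_of_lt_right one_pos
  refine ⟨min (V / 2) (M ^ n)⁻¹, by positivity, fun R hR => ?_⟩
  rcases le_total M R with hMR | hRM
  · have hle := hR₀ R ((le_max_left _ _).trans hMR)
    rw [le_div_iff₀ (pow_pos (hM.trans_le hMR) _)] at hle
    refine le_trans ?_ hle
    gcongr
    exact min_le_left _ _
  · calc min (V / 2) (M ^ n)⁻¹ * R ^ n ≤ (M ^ n)⁻¹ * M ^ n := by
          gcongr
          exact min_le_right _ _
      _ = 1 := inv_mul_cancel₀ (by positivity)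
      _ ≤ _ := by exact_mod_cast (Set.ncard_pos (Northcott.finite_le R)).2 ⟨a, ha.trans hR⟩

theorem exists_ncard_le_mul_pow (hh : HasGrowth h n) :
    ∃ κ : ℝ, 0 < κ ∧ ∀ R : ℝ, 1 ≤ R → (({b | h b ≤ R} : Set G).ncard : ℝ) ≤ κ * R ^ n := by
  have := hh.northcott
  obtain ⟨V, hV, hlim⟩ := hh
  obtain ⟨R₀, hR₀⟩ := eventually_atTop.1 (hlim.eventually_le_const (lt_add_one V))
  set M := max R₀ 1
  have hM : 0 < M := lt_max_of_lt_right one_pos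
  have hbound : ∀ R, M ≤ R → (({b | h b ≤ R} : Set G).ncard : ℝ) ≤ (V + 1) * R ^ n :=
    fun R hR => (div_le_iff₀ (pow_pos (hM.trans_le hR) n)).1 (hR₀ R ((le_max_left _ _).trans hR))
  refine ⟨(V + 1) * M ^ n, by positivity, fun R hR => ?_⟩
  have hMR : M ≤ M * R := le_mul_of_one_le_right hM.le hR
  calc (({b | h b ≤ R} : Set G).ncard : ℝ) ≤ ({b | h b ≤ M * R} : Set G).ncard := by
        have hR' : R ≤ M * R := le_mul_of_one_le_left (by linarith) (le_max_right _ _)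
        have hsub : {b | h b ≤ R} ⊆ {b | h b ≤ M * R} := fun b hb => le_trans hb hR'
        exact_mod_cast Set.ncard_le_ncard hsub (Northcott.finite_le _)
    _ ≤ (V + 1) * (M * R) ^ n := hbound _ hMR
    _ = (V + 1) * M ^ n * R ^ n := by rw [mul_pow, mul_assoc]

theorem eventually_ncard_pos (hh : HasGrowth h n) :
    ∀ᶠ R in atTop, 0 < ({b | h b ≤ R} : Set G).ncard := by
  obtain ⟨V, hV, hlim⟩ := hh
  filter_upwards [hlim.eventually_const_lt hV] with R hR
  exact Nat.pos_of_ne_zero fun h0 => by simp [h0] at hR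

theorem tendsto_ncard (hh : HasGrowth h n) (hn : n ≠ 0) :
    Tendsto (fun R : ℝ => (({b | h b ≤ R} : Set G).ncard : ℝ)) atTop atTop := by
  obtain ⟨V, hV, hlim⟩ := hh
  refine (hlim.pos_mul_atTop hV (tendsto_pow_atTop hn)).congr' ?_
  filter_upwards [eventually_gt_atTop 0] with R hR
  exact div_mul_cancel₀ _ (by positivity)

theorem tendsto_ncard_add_div_ncard (hh : HasGrowth h n) (C : ℝ) :
    Tendsto (fun R : ℝ => (({b | h b ≤ R + C} : Set G).ncard : ℝ) /
      ({b | h b ≤ R} : Set G).ncard) atTop (𝓝 1) := by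
  obtain ⟨V, hV, hlim⟩ := hh
  have hratio : Tendsto (fun R : ℝ => ((R + C) / R) ^ n) atTop (𝓝 1) := by
    have hsum : Tendsto (fun R : ℝ => 1 + C / R) atTop (𝓝 (1 + 0)) :=
      tendsto_const_nhds.add (tendsto_const_nhds.div_atTop tendsto_id)
    have hpow := hsum.pow n
    rw [add_zero, one_pow] at hpow
    refine hpow.congr' ?_
    filter_upwards [eventually_ne_atTop 0] with R hR
    rw [add_div, div_self hR]
  have hshift := hlim.comp (tendsto_atTop_add_const_right atTop C tendsto_id)
  have hprod := (hshift.div hlim hV.ne').mul hratio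
  rw [div_self hV.ne', one_mul] at hprod
  refine hprod.congr' ?_
  filter_upwards [eventually_gt_atTop 0, eventually_gt_atTop (-C)] with R hR hRC
  have hRC' : 0 < R + C := by linarith
  simp only [Pi.div_apply, Function.comp_apply, id, div_pow]
  field_simp

theorem hasDensity_univ (hh : HasGrowth h n) : HasDensity h Set.univ 1 := by
  refine tendsto_const_nhds.congr' ?_
  filter_upwards [hh.eventually_ncard_pos] with R hR
  rw [proportion, Set.univ_inter, div_self (by positivity)]

theorem hasDensity_of_finite (hh : HasGrowth h n) (hn : n ≠ 0) {X : Set G} (hX : X.Finite) :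
    HasDensity h X 0 := by
  refine squeeze_zero (proportion_nonneg h X) (fun R => ?_)
    ((tendsto_const_nhds (x := (X.ncard : ℝ))).div_atTop (hh.tendsto_ncard hn))
  unfold proportion
  gcongr
  exact Set.inter_subset_left

theorem hasDensity_compl (hh : HasGrowth h n) {X : Set G} {δ : ℝ} (hX : HasDensity h X δ) :
    HasDensity h Xᶜ (1 - δ) := by
  have := hh.northcott
  refine (hh.hasDensity_univ.sub hX).congr fun R => ?_
  rw [← Set.union_compl_self X, proportion_union disjoint_compl_right, add_sub_cancel_left]

theorem tendsto_ncard_div_ncard (hh : HasGrowth h n) {X Y : Set G} {δ δ' : ℝ}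
    (hX : HasDensity h X δ) (hY : HasDensity h Y δ') (hδ' : δ' ≠ 0) :
    Tendsto (fun R => ((X ∩ {b | h b ≤ R}).ncard : ℝ) / (Y ∩ {b | h b ≤ R}).ncard) atTop
      (𝓝 (δ / δ')) := by
  refine (hX.div hY hδ').congr' ?_
  filter_upwards [hh.eventually_ncard_pos] with R hR
  exact div_div_div_cancel_right₀ (by positivity) _ _

end HasGrowth
end Growth

section Sieve

variable {G : Type*} {h : G → ℝ} [Northcott h]

theorem HasDensity.le_of_proportion_sdiff_le {X Z : Set G} {δ u : ℝ} (hX : HasDensity h X δ)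
    (hZ : HasDensity h Z 0) (hu : ∀ᶠ R in atTop, proportion h (X \ Z) R ≤ u) : δ ≤ u := by
  refine le_of_tendsto_of_tendsto hX (by simpa using hZ.const_add u) ?_
  filter_upwards [hu] with R hR
  calc proportion h X R ≤ proportion h (X \ Z ∪ Z) R :=
        proportion_mono (Set.subset_sdiff_union X Z) R
    _ ≤ proportion h (X \ Z) R + proportion h Z R := proportion_union_le h _ _ R
    _ ≤ u + proportion h Z R := by gcongr

theorem HasDensity.of_tendsto {ι : Type*} {l : Filter ι} [l.NeBot] {X : Set G} {Y : ι → Set G}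
    {D : ι → ℝ} {δ : ℝ} (hXY : ∀ i, X ⊆ Y i) (hY : ∀ i, HasDensity h (Y i) (D i))
    (hD : Tendsto D l (𝓝 δ))
    (hdiff : ∀ ε > 0, ∀ᶠ i in l, ∀ᶠ R in atTop, proportion h (Y i \ X) R ≤ ε) :
    HasDensity h X δ := by
  refine Metric.tendsto_nhds.2 fun ε hε => ?_
  have hε3 : 0 < ε / 3 := by positivity
  obtain ⟨i, hDi, hi⟩ := ((Metric.tendsto_nhds.1 hD _ hε3).and (hdiff _ hε3)).exists
  filter_upwards [hi, Metric.tendsto_nhds.1 (hY i) _ hε3] with R hR hYR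
  have hsplit : proportion h (Y i) R = proportion h X R + proportion h (Y i \ X) R := by
    rw [← proportion_union disjoint_sdiff_self_right, Set.union_sdiff_cancel (hXY i)]
  have hnonneg := proportion_nonneg h (Y i \ X) R
  rw [Real.dist_eq, abs_lt] at *
  constructor <;> linarith [hDi.1, hDi.2, hYR.1, hYR.2]

theorem hasDensity_forall_notMem {α : Type*} {T Z : Set G} {B : α → Set G} {D : Finset α → ℝ}
    {δ : ℝ} {u : α → ℝ} (hfin : ∀ P, HasDensity h {b | b ∈ T ∧ ∀ p ∈ P, b ∉ B p} (D P))
    (hD : Tendsto D atTop (𝓝 δ)) (hZ : HasDensity h Z 0) (hu : Summable u) {P₀ : Finset α}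
    (hB : ∀ᶠ R in atTop, ∀ p ∉ P₀, proportion h (B p \ Z) R ≤ u p) :
    HasDensity h {b | b ∈ T ∧ ∀ p, b ∉ B p} δ := by
  have hsub : ∀ P : Finset α,
      {b | b ∈ T ∧ ∀ p, b ∉ B p} ⊆ {b | b ∈ T ∧ ∀ p ∈ P, b ∉ B p} :=
    fun P b hb => ⟨hb.1, fun p _ => hb.2 p⟩
  refine .of_tendsto hsub hfin hD fun ε hε => ?_
  filter_upwards [(tendsto_tsum_compl_atTop_zero u).eventually_lt_const (half_pos hε),
    eventually_ge_atTop P₀] with P htail hP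
  filter_upwards [hB, hZ.eventually_lt_const (half_pos hε)] with R hR hZR
  have hcover : {b | b ∈ T ∧ ∀ p ∈ P, b ∉ B p} \ {b | b ∈ T ∧ ∀ p, b ∉ B p} ⊆
      (⋃ p : {p // p ∉ P}, B p \ Z) ∪ Z := by
    rintro b ⟨⟨hbT, hbP⟩, hb⟩
    obtain ⟨p, hp⟩ : ∃ p, b ∈ B p := by simpa [hbT] using hb
    by_cases hbZ : b ∈ Z
    · exact Or.inr hbZ
    · exact Or.inl (Set.mem_iUnion.2 ⟨⟨p, fun hpP => hbP p hpP hp⟩, hp, hbZ⟩)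
  have hunion : proportion h (⋃ p : {p // p ∉ P}, B p \ Z) R ≤ ∑' p : {p // p ∉ P}, u p :=
    proportion_iUnion_le_tsum (hu.subtype _) fun p => hR p fun hp => p.2 (hP hp)
  linarith [proportion_mono (h := h) hcover R,
    proportion_union_le h (⋃ p : {p // p ∉ P}, B p \ Z) Z R]

end Sieve

section Equidistribution

variable {G Q F : Type*} [AddGroup G] [AddGroup Q] [Finite Q] [FunLike F G ℝ]
  [AddGroupSeminormClass F G ℝ] {ν : F} {f : G →+ Q}

theorem exists_ncard_fiber_le_ncard_fiber [Northcott ν] (hf : Function.Surjective f) :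
    ∃ C : ℝ, ∀ (y y' : Q) (R : ℝ), (f ⁻¹' {y} ∩ {b | ν b ≤ R}).ncard ≤
      (f ⁻¹' {y'} ∩ {b | ν b ≤ R + C}).ncard := by
  choose s hs using hf
  obtain ⟨C, hC⟩ := (Set.finite_range fun y : Q × Q => ν (s (-y.1 + y.2))).bddAbove
  refine ⟨C, fun y y' R => Set.ncard_le_ncard_of_injOn (· + s (-y + y')) ?_
    (add_left_injective _).injOn ((Northcott.finite_le _).inter_of_right _)⟩
  rintro b ⟨hb, hbR⟩
  have hby : f b = y := hb
  refine ⟨?_, (map_add_le_add ν _ _).trans (add_le_add hbR (hC ⟨(y, y'), rfl⟩))⟩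
  simp [hby, hs]

theorem sum_ncard_fiber {G Q : Type*} [Fintype Q] (f : G → Q) {X : Set G} (hX : X.Finite) :
    ∑ y, (f ⁻¹' {y} ∩ X).ncard = X.ncard := by
  rw [← finsum_eq_sum_of_fintype,
    ← Set.ncard_iUnion_of_finite fun y => hX.inter_of_right _]
  · congr 1
    ext b
    simp
  · exact fun y y' hyy' => Set.disjoint_left.2 fun b hb hb' => hyy' (hb.1.symm.trans hb'.1)

variable {n : ℕ}

theorem HasGrowth.hasDensity_fiber (hν : HasGrowth ν n) (hf : Function.Surjective f) (y : Q) :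
    HasDensity ν (f ⁻¹' {y}) (1 / Nat.card Q) := by
  have := hν.northcott
  have := Fintype.ofFinite Q
  have hQ : (0 : ℝ) < Nat.card Q := by exact_mod_cast Nat.card_pos
  obtain ⟨C, hC⟩ := exists_ncard_fiber_le_ncard_fiber (ν := ν) hf
  have hupper : ∀ R, Nat.card Q * (f ⁻¹' {y} ∩ {b | ν b ≤ R}).ncard ≤
      ({b | ν b ≤ R + C} : Set G).ncard := fun R => by
    rw [← sum_ncard_fiber f (Northcott.finite_le (R + C)), ← smul_eq_mul,
      Nat.card_eq_fintype_card]
    exact Finset.card_nsmul_le_sum _ _ _ fun y' _ => hC y y' R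
  have hlower : ∀ R, ({b | ν b ≤ R + -C} : Set G).ncard ≤
      Nat.card Q * (f ⁻¹' {y} ∩ {b | ν b ≤ R}).ncard := fun R => by
    rw [← sum_ncard_fiber f (Northcott.finite_le (R + -C)), ← smul_eq_mul,
      Nat.card_eq_fintype_card]
    refine Finset.sum_le_card_nsmul _ _ _ fun y' _ => ?_
    simpa using hC y' y (R + -C)
  refine tendsto_of_tendsto_of_tendsto_of_le_of_le
    ((hν.tendsto_ncard_add_div_ncard (-C)).div_const (Nat.card Q : ℝ))
    ((hν.tendsto_ncard_add_div_ncard C).div_const (Nat.card Q : ℝ)) (fun R => ?_) fun R => ?_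
  · rw [div_right_comm, proportion]
    gcongr
    rw [div_le_iff₀' hQ]
    exact_mod_cast hlower R
  · simp only [div_right_comm _ _ (Nat.card Q : ℝ), proportion]
    gcongr
    rw [le_div_iff₀' hQ]
    exact_mod_cast hupper R

theorem HasGrowth.hasDensity_preimage (hν : HasGrowth ν n) (hf : Function.Surjective f)
    (Y : Set Q) : HasDensity ν (f ⁻¹' Y) (Y.ncard / Nat.card Q) := by
  have := hν.northcott
  induction Y, Set.toFinite Y using Set.Finite.induction_on with
  | empty => simpa using hν.hasDensity_compl hν.hasDensity_univ
  | @insert y Y hy hY ih =>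
    rw [Set.ncard_insert_of_notMem hy hY, Nat.cast_add, Nat.cast_one, add_comm, add_div]
    refine ((hν.hasDensity_fiber hf y).add ih).congr fun R => ?_
    rw [Set.insert_eq, Set.preimage_union, proportion_union]
    exact Disjoint.preimage _ (Set.disjoint_singleton_left.2 hy)

theorem HasGrowth.hasDensity_forall_mk_mem {A F ι : Type*} [CommRing A] [FunLike F A ℝ]
    [AddGroupSeminormClass F A ℝ] {ν : F} (hν : HasGrowth ν n) [Fintype ι] {I : ι → Ideal A}
    [∀ i, Finite (A ⧸ I i)] (hI : Pairwise (Function.onFun IsCoprime I))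
    (Y : ∀ i, Set (A ⧸ I i)) :
    HasDensity ν {b | ∀ i, Ideal.Quotient.mk (I i) b ∈ Y i}
      (∏ i, ((Y i).ncard : ℝ) / Nat.card (A ⧸ I i)) := by
  let f : A →+ ∀ i, A ⧸ I i := (RingHom.pi fun i => Ideal.Quotient.mk (I i)).toAddMonoidHom
  have hf : Function.Surjective f := fun x =>
    (Ideal.pi_quotient_surjective hI x).imp fun b hb => funext hb
  convert hν.hasDensity_preimage hf (Set.univ.pi Y) using 1
  · ext b
    simp only [Set.mem_preimage, Set.mem_univ_pi]
    rfl
  · rw [Nat.card_pi, ← Nat.card_coe_set_eq, Nat.card_congr (Equiv.Set.univPi Y), Nat.card_pi,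
      Finset.prod_div_distrib]
    simp [Nat.card_coe_set_eq]

theorem HasGrowth.hasDensity_mk_mem_and_forall_mk_mem {A F ι : Type*} [CommRing A] [FunLike F A ℝ]
    [AddGroupSeminormClass F A ℝ] {ν : F} (hν : HasGrowth ν n) [Fintype ι] {I₀ : Ideal A}
    {I : ι → Ideal A} [Finite (A ⧸ I₀)] [∀ i, Finite (A ⧸ I i)] (hI₀ : ∀ i, IsCoprime I₀ (I i))
    (hI : Pairwise (Function.onFun IsCoprime I)) (Y₀ : Set (A ⧸ I₀)) (Y : ∀ i, Set (A ⧸ I i)) :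
    HasDensity ν {b | Ideal.Quotient.mk I₀ b ∈ Y₀ ∧ ∀ i, Ideal.Quotient.mk (I i) b ∈ Y i}
      (Y₀.ncard / Nat.card (A ⧸ I₀) * ∏ i, ((Y i).ncard : ℝ) / Nat.card (A ⧸ I i)) := by
  let I' : Option ι → Ideal A := fun o => o.elim I₀ I
  have hfin : ∀ o, Finite (A ⧸ I' o) := Option.rec ‹_› ‹_›
  have hcoprime : Pairwise (Function.onFun IsCoprime I') := by
    rintro (_ | i) (_ | j) hij
    · exact absurd rfl hij
    · exact hI₀ j
    · exact (hI₀ i).symm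
    · exact hI fun h => hij (congrArg some h)
  let Y' : ∀ o, Set (A ⧸ I' o) := Option.rec Y₀ Y
  have hdensity := hν.hasDensity_forall_mk_mem hcoprime Y'
  simp only [Option.forall, Fintype.prod_option] at hdensity
  exact hdensity

end Equidistribution

section Packing

theorem ncard_mul_ncard_le_ncard_add {G F : Type*} [AddCommGroup G] [FunLike F G ℝ]
    [AddGroupSeminormClass F G ℝ] {ν : F} [Northcott ν] {X : Set G} {R ρ : ℝ}
    (hX : X ⊆ {b | ν b ≤ R}) (hsep : X.Pairwise fun b b' => 2 * ρ < ν (b - b')) :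
    X.ncard * ({b | ν b ≤ ρ} : Set G).ncard ≤ ({b | ν b ≤ R + ρ} : Set G).ncard := by
  rw [← Set.ncard_prod]
  refine Set.ncard_le_ncard_of_injOn (fun x => x.1 + x.2) ?_ ?_ (Northcott.finite_le _)
  · rintro ⟨b, x⟩ ⟨hb, hx⟩
    exact (map_add_le_add ν _ _).trans (add_le_add (hX hb) hx)
  · rintro ⟨b, x⟩ ⟨hb, hx : ν x ≤ ρ⟩ ⟨b', x'⟩ ⟨hb', hx' : ν x' ≤ ρ⟩ (hsum : b + x = b' + x')
    have hbb' : b = b' := hsep.eq hb hb' <| not_lt.2 <| by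
      calc ν (b - b') = ν (x' - x) := by
            rw [sub_eq_sub_iff_add_eq_add.2 (hsum.trans (add_comm b' x'))]
        _ ≤ ν x' + ν x := map_sub_le_add ν _ _
        _ ≤ 2 * ρ := by linarith
    exact Prod.ext hbb' (add_left_cancel (hbb' ▸ hsum))

variable {n : ℕ}

theorem HasGrowth.exists_proportion_le_of_pairwise {G F : Type*} [AddCommGroup G] [FunLike F G ℝ]
    [AddGroupSeminormClass F G ℝ] {ν : F} (hν : HasGrowth ν n) :
    ∃ C : ℝ, 0 ≤ C ∧ ∀ (X : Set G) (R ρ : ℝ), 1 ≤ R → 0 < ρ →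
      (X ∩ {b | ν b ≤ R}).Pairwise (fun b b' => 2 * ρ < ν (b - b')) →
        proportion ν X R ≤ C * (ρ⁻¹ + R⁻¹) ^ n := by
  have := hν.northcott
  obtain ⟨κ, hκ, hlower⟩ := hν.exists_mul_pow_le_ncard (map_zero ν).le
  obtain ⟨κ', hκ', hupper⟩ := hν.exists_ncard_le_mul_pow
  refine ⟨κ' / (κ * κ), by positivity, fun X R ρ hR hρ hsep => ?_⟩
  have hR0 : 0 < R := by linarith
  have _ : 0 < κ * R ^ n := by positivity
  have hpack : ((X ∩ {b | ν b ≤ R}).ncard : ℝ) * (κ * ρ ^ n) ≤ κ' * (R + ρ) ^ n := by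
    calc ((X ∩ {b | ν b ≤ R}).ncard : ℝ) * (κ * ρ ^ n)
        ≤ (X ∩ {b | ν b ≤ R}).ncard * ({b | ν b ≤ ρ} : Set G).ncard := by
          gcongr
          exact hlower ρ hρ.le
      _ ≤ ({b | ν b ≤ R + ρ} : Set G).ncard := by
          exact_mod_cast ncard_mul_ncard_le_ncard_add Set.inter_subset_right hsep
      _ ≤ κ' * (R + ρ) ^ n := hupper _ (by linarith)
  calc proportion ν X R ≤ (X ∩ {b | ν b ≤ R}).ncard / (κ * R ^ n) := by
        unfold proportion
        gcongr
        exact hlower R hR0.le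
    _ ≤ κ' * (R + ρ) ^ n / (κ * ρ ^ n) / (κ * R ^ n) := by
        gcongr
        rwa [le_div_iff₀ (by positivity)]
    _ = κ' / (κ * κ) * (ρ⁻¹ + R⁻¹) ^ n := by
        rw [inv_add_inv hρ.ne' hR0.ne', div_pow, mul_pow, add_comm R]
        field_simp

theorem HasGrowth.exists_proportion_affine_le {A F σ : Type*} [Ring A] [FunLike F A ℝ]
    [RingSeminormClass F A ℝ] {ν : F} (hν : HasGrowth ν n) [SetLike σ A] [AddSubgroupClass σ A]
    {c : A} (hc : IsLeftRegular c) (d : A) :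
    ∃ C : ℝ, ∀ (J : σ) (t : ℝ), 0 < t → (∀ x ∈ J, x ≠ 0 → t ≤ ν x) → ∀ R : ℝ, 1 ≤ R →
      proportion ν {b | c * b + d ∈ J ∧ c * b + d ≠ 0} R ≤ C / t ^ n := by
  obtain ⟨C, hC, hsparse⟩ := hν.exists_proportion_le_of_pairwise
  set m := ν c + ν d + 1
  have hνc : 0 ≤ ν c := apply_nonneg ν c
  have hνd : 0 ≤ ν d := apply_nonneg ν d
  refine ⟨C * (4 * m) ^ n, fun J t ht hJ R hR => ?_⟩
  set X := {b | c * b + d ∈ J ∧ c * b + d ≠ 0}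
  rcases (X ∩ {b | ν b ≤ R}).eq_empty_or_nonempty with hempty | ⟨b₀, ⟨hb₀J, hb₀⟩, hb₀R : ν b₀ ≤ R⟩
  · rw [proportion, hempty, Set.ncard_empty, Nat.cast_zero, zero_div]
    positivity
  have htR : t ≤ m * R := by
    calc t ≤ ν (c * b₀ + d) := hJ _ hb₀J hb₀
      _ ≤ ν c * ν b₀ + ν d :=
        (map_add_le_add ν _ _).trans (add_le_add_left (map_mul_le_mul ν _ _) _)
      _ ≤ m * R := by nlinarith
  have hsep : (X ∩ {b | ν b ≤ R}).Pairwise fun b b' => 2 * (t / (3 * m)) < ν (b - b') := by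
    intro b hb b' hb' hne
    have hmem : c * (b - b') ∈ J := by
      simpa [mul_sub] using sub_mem hb.1.1 hb'.1.1
    have hne0 : c * (b - b') ≠ 0 := fun h0 =>
      hne (hc (sub_eq_zero.1 (by rwa [mul_sub] at h0)))
    have hle : t ≤ m * ν (b - b') := by
      have hmul := (hJ _ hmem hne0).trans (map_mul_le_mul ν _ _)
      nlinarith [apply_nonneg ν (b - b')]
    rw [← mul_div_assoc, div_lt_iff₀ (by positivity)]
    nlinarith
  refine (hsparse X R _ hR (by positivity) hsep).trans ?_
  rw [mul_div_assoc, ← div_pow]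
  gcongr
  have hRt : R⁻¹ ≤ m / t := by
    rw [inv_le_comm₀ (by positivity) (by positivity), inv_div, div_le_iff₀' (by positivity)]
    exact htR
  calc (t / (3 * m))⁻¹ + R⁻¹ ≤ 3 * m / t + m / t := by rw [inv_div]; gcongr
    _ = 4 * m / t := by ring

end Packing

section LatticeCount

open MeasureTheory Pointwise

theorem coe_span_range_basisFun (ι : Type*) [Finite ι] :
    (Submodule.span ℤ (Set.range (Pi.basisFun ℝ ι)) : Set (ι → ℝ)) =
      Set.range fun z : ι → ℤ => fun i => (z i : ℝ) := by
  ext w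
  simp [Module.Basis.mem_span_iff_repr_mem, funext_iff, Classical.skolem]

theorem ncard_closedBall_inter_inv_smul_lattice {ι M E : Type*} [Fintype ι] [AddCommGroup M]
    [NormedAddCommGroup E] [NormedSpace ℝ E] (ω : Module.Basis ι ℤ M) (φ : M →+ E) {R : ℝ}
    (hR : 0 < R) :
    (Fintype.linearCombination ℝ (φ ∘ ω) ⁻¹' Metric.closedBall 0 1 ∩
      R⁻¹ • (Submodule.span ℤ (Set.range (Pi.basisFun ℝ ι)) : Set (ι → ℝ))).ncard =
        {x | ‖φ x‖ ≤ R}.ncard := by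
  set f := Fintype.linearCombination ℝ (φ ∘ ω)
  set coords : M → ι → ℝ := fun x => R⁻¹ • fun i => (ω.equivFun x i : ℝ)
  have hinj : Function.Injective coords := fun x y hxy => ω.equivFun.injective <| funext fun i => by
    exact_mod_cast congrFun (smul_right_injective (ι → ℝ) (inv_ne_zero hR.ne') hxy) i
  have hrange : R⁻¹ • (Submodule.span ℤ (Set.range (Pi.basisFun ℝ ι)) : Set (ι → ℝ)) =
      Set.range coords := by
    rw [coe_span_range_basisFun, ← ω.equivFun.surjective.range_comp, ← Set.range_smul]
    rfl
  have hf : ∀ x, f (coords x) = R⁻¹ • φ x := fun x => by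
    conv_rhs => rw [← ω.sum_equivFun x, map_sum]
    simp [f, coords, Fintype.linearCombination_apply, Finset.smul_sum, Int.cast_smul_eq_zsmul]
  rw [hrange, ← Set.image_preimage_eq_inter_range, Set.ncard_image_of_injective _ hinj]
  congr 1
  ext x
  simp only [Set.mem_preimage, hf, mem_closedBall_zero_iff, norm_smul, norm_inv,
    Real.norm_of_nonneg hR.le, inv_mul_le_iff₀ hR, mul_one, Set.mem_ofPred_eq]

theorem hasGrowth_norm_of_linearIndependent {ι M E : Type*} [Fintype ι] [AddCommGroup M]
    [NormedAddCommGroup E] [NormedSpace ℝ E] (ω : Module.Basis ι ℤ M) (φ : M →+ E)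
    (hφ : LinearIndependent ℝ (φ ∘ ω)) : HasGrowth (fun x => ‖φ x‖) (Fintype.card ι) := by
  set f := Fintype.linearCombination ℝ (φ ∘ ω)
  have hcont : Continuous f := f.continuous_of_finiteDimensional
  set s := f ⁻¹' Metric.closedBall 0 1 with hs
  have hconv : Convex ℝ s := (convex_closedBall (0 : E) 1).linear_preimage f
  have hclosed : IsClosed s := Metric.isClosed_closedBall.preimage hcont
  have hbdd : Bornology.IsBounded s := by
    obtain ⟨C, -, hC⟩ := f.exists_antilipschitzWith
      (LinearMap.ker_eq_bot.2 hφ.fintypeLinearCombination_injective)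
    exact hC.isBounded_preimage Metric.isBounded_closedBall
  have hpos : 0 < volume s := by
    refine Measure.measure_pos_of_mem_nhds volume (x := 0) (hcont.continuousAt.preimage_mem_nhds ?_)
    rw [map_zero]
    exact Metric.closedBall_mem_nhds 0 one_pos
  have hmono : ∀ ⦃x y : ℝ⦄, 0 < x → x ≤ y → x • s ⊆ y • s := by
    intro x y hx hxy v hv
    have hy := hx.trans_le hxy
    simp only [Set.mem_smul_set_iff_inv_smul_mem₀ hx.ne', hs, Set.mem_preimage, map_smul,
      mem_closedBall_zero_iff, norm_smul, norm_inv, Real.norm_of_nonneg hx.le,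
      inv_mul_le_iff₀ hx] at hv
    simp only [Set.mem_smul_set_iff_inv_smul_mem₀ hy.ne', hs, Set.mem_preimage, map_smul,
      mem_closedBall_zero_iff, norm_smul, norm_inv, Real.norm_of_nonneg hy.le,
      inv_mul_le_iff₀ hy]
    linarith
  refine ⟨volume.real s, ENNReal.toReal_pos hpos.ne' hbdd.measure_lt_top.ne,
    (tendsto_card_div_pow_atTop_volume' s hbdd hclosed.measurableSet
      (hconv.addHaar_frontier volume) hmono).congr' ?_⟩
  filter_upwards [eventually_gt_atTop 0] with R hR
  rw [Nat.card_coe_set_eq, ncard_closedBall_inter_inv_smul_lattice ω φ hR]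

end LatticeCount

section PrimeSums

theorem summable_comp_of_card_le {α β : Type*} {g : β → ℝ} (hg0 : ∀ b, 0 ≤ g b)
    (hg : Summable g) {φ : α → β} {n : ℕ}
    (hφ : ∀ (b : β) (F : Finset α), (∀ a ∈ F, φ a = b) → F.card ≤ n) : Summable (g ∘ φ) := by
  classical
  refine summable_of_sum_le (c := n * ∑' b, g b) (fun a => hg0 _) fun s => ?_
  calc ∑ a ∈ s, (g ∘ φ) a = ∑ b ∈ s.image φ, (s.filter (φ · = b)).card • g b :=
        Finset.sum_comp g φ
    _ ≤ ∑ b ∈ s.image φ, n * g b := by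
        refine Finset.sum_le_sum fun b _ => ?_
        rw [nsmul_eq_mul]
        gcongr
        · exact hg0 b
        · exact hφ b _ fun a ha => (Finset.mem_filter.1 ha).2
    _ ≤ n * ∑' b, g b := by
        rw [← Finset.mul_sum]
        gcongr
        exact hg.sum_le_tsum _ fun b _ => hg0 b

variable {R : Type*} [CommRing R] [IsDedekindDomain R] [Module.Free ℤ R] [Module.Finite ℤ R]

theorem absNorm_under_le_absNorm {I : Ideal R} (hI : I ≠ ⊥) :
    Ideal.absNorm (I.under ℤ) ≤ Ideal.absNorm I :=
  Nat.le_of_dvd (Nat.pos_of_ne_zero (mt Ideal.absNorm_eq_zero_iff.1 hI))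
    (Int.absNorm_under_dvd_absNorm I)

theorem card_le_finrank_of_absNorm_under_eq {ℓ : ℕ} (hℓ : ℓ.Prime)
    {F : Finset (HeightOneSpectrum R)}
    (hF : ∀ p ∈ F, Ideal.absNorm (p.asIdeal.under ℤ) = ℓ) : F.card ≤ Module.finrank ℤ R := by
  have hdvd : ∏ p ∈ F, p.asIdeal ∣ Ideal.span {(ℓ : R)} := by
    refine Finset.prod_dvd_of_coprime ?_ ?_
    · exact fun p _ p' _ hpp' => p.isCoprime_of_ne p' hpp'
    · intro p hp
      rw [Ideal.dvd_span_singleton, ← hF p hp]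
      exact Int.absNorm_under_mem _
  have hnorm : Ideal.absNorm (Ideal.span {(ℓ : R)}) = ℓ ^ Module.finrank ℤ R :=
    Ideal.absNorm_span_natCast ℓ
  refine (Nat.pow_le_pow_iff_right hℓ.one_lt).1 ?_
  calc ℓ ^ F.card ≤ ∏ p ∈ F, Ideal.absNorm p.asIdeal := by
        refine Finset.pow_card_le_prod _ _ _ fun p hp => ?_
        rw [← hF p hp]
        exact absNorm_under_le_absNorm p.ne_bot
    _ = Ideal.absNorm (∏ p ∈ F, p.asIdeal) := (map_prod _ _ _).symm
    _ ≤ ℓ ^ Module.finrank ℤ R := by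
        rw [← hnorm]
        refine Nat.le_of_dvd ?_ (Ideal.absNorm_dvd_absNorm_of_le (Ideal.le_of_dvd hdvd))
        rw [hnorm]
        exact pow_pos hℓ.pos _

theorem summable_absNorm_inv_sq :
    Summable fun p : HeightOneSpectrum R => ((Ideal.absNorm p.asIdeal : ℝ) ^ 2)⁻¹ := by
  have hcomp : Summable ((fun ℓ : ℕ => ((ℓ : ℝ) ^ 2)⁻¹) ∘
      fun p : HeightOneSpectrum R => Ideal.absNorm (p.asIdeal.under ℤ)) := by
    refine summable_comp_of_card_le (n := Module.finrank ℤ R) (fun _ => by positivity)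
      (Real.summable_nat_pow_inv.2 one_lt_two) fun ℓ F hF => ?_
    rcases F.eq_empty_or_nonempty with rfl | ⟨p, hp⟩
    · simp
    · refine card_le_finrank_of_absNorm_under_eq ?_ hF
      rw [← hF p hp]
      have : NeZero p.asIdeal := ⟨p.ne_bot⟩
      exact Nat.absNorm_under_prime p.asIdeal
  refine hcomp.of_nonneg_of_le (fun _ => by positivity) fun p => ?_
  have : NeZero p.asIdeal := ⟨p.ne_bot⟩
  have hpos : 0 < Ideal.absNorm (p.asIdeal.under ℤ) := (Nat.absNorm_under_prime p.asIdeal).pos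
  simp only [Function.comp_apply]
  gcongr
  exact absNorm_under_le_absNorm p.ne_bot

end PrimeSums

section EmbeddingNorm

variable {K : Type*} [Field K] [NumberField K]

theorem absNorm_le_pow_of_mem {J : Ideal (𝓞 K)} {x : 𝓞 K} (hx : x ∈ J) (hx0 : x ≠ 0) {r : ℝ}
    (hr : ∀ σ : K →+* ℂ, ‖σ x‖ ≤ r) : (Ideal.absNorm J : ℝ) ≤ r ^ Module.finrank ℚ K := by
  have hpos : 0 < Ideal.absNorm (Ideal.span {x}) :=
    Nat.pos_of_ne_zero (mt Ideal.absNorm_eq_zero_iff.1 (by simpa using hx0))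
  have hle : Ideal.absNorm J ≤ Ideal.absNorm (Ideal.span {x}) :=
    Nat.le_of_dvd hpos (Ideal.absNorm_dvd_absNorm_of_le ((Ideal.span_singleton_le_iff_mem J).2 hx))
  calc (Ideal.absNorm J : ℝ) ≤ Ideal.absNorm (Ideal.span {x}) := by exact_mod_cast hle
    _ = ∏ w : InfinitePlace K, w (x : K) ^ w.mult := by
        rw [InfinitePlace.prod_eq_abs_norm, Ideal.absNorm_span_singleton, ← Algebra.coe_norm_int]
        simp [Nat.cast_natAbs]
    _ ≤ ∏ w : InfinitePlace K, r ^ w.mult := by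
        gcongr with w
        rw [← InfinitePlace.norm_embedding_eq]
        exact hr _
    _ = r ^ Module.finrank ℚ K := by
        rw [Finset.prod_pow_eq_pow_sum, InfinitePlace.sum_mult_eq]

variable (q : ℕ) [Fact (1 ≤ (q : ENNReal))]

/-- The embedding of `𝓞 K` into `ℂ ^ [K : ℚ]` by the conjugates, with values in the space carrying
the `ℓ^q` norm. -/
def lpEmbedding : 𝓞 K →+ PiLp (q : ENNReal) fun _ : K →+* ℂ => ℂ where
  toFun b := WithLp.toLp _ fun σ => σ b
  map_zero' := by ext; simp
  map_add' a b := by ext; simp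

theorem norm_apply_le_norm_lpEmbedding (σ : K →+* ℂ) (b : 𝓞 K) : ‖σ b‖ ≤ ‖lpEmbedding q b‖ :=
  PiLp.norm_apply_le (lpEmbedding q b) σ

theorem norm_lpEmbedding_pow (b : 𝓞 K) :
    ‖lpEmbedding q b‖ ^ q = ∑ σ : K →+* ℂ, ‖σ b‖ ^ q := by
  have hq : 0 < q := by exact_mod_cast (Fact.out : 1 ≤ (q : ENNReal))
  rw [PiLp.norm_eq_of_nat q rfl, one_div, Real.rpow_inv_natCast_pow (by positivity) hq.ne']
  rfl

theorem norm_lpEmbedding_mul_le (b c : 𝓞 K) :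
    ‖lpEmbedding q (b * c)‖ ≤ ‖lpEmbedding q b‖ * ‖lpEmbedding q c‖ := by
  have hq : 0 < q := by exact_mod_cast (Fact.out : 1 ≤ (q : ENNReal))
  refine (pow_le_pow_iff_left₀ (norm_nonneg _) (by positivity) hq.ne').1 ?_
  rw [mul_pow, norm_lpEmbedding_pow, norm_lpEmbedding_pow, norm_lpEmbedding_pow]
  simp only [map_mul, norm_mul, mul_pow]
  rw [Finset.sum_mul]
  gcongr with σ
  exact Finset.single_le_sum (f := fun τ : K →+* ℂ => ‖τ c‖ ^ q) (fun _ _ => by positivity)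
    (Finset.mem_univ σ)

/-- The `ℓ^q` norm of the vector of conjugates, as a ring seminorm on `𝓞 K`. -/
def embeddingNorm : RingSeminorm (𝓞 K) where
  __ := (normAddGroupSeminorm _).comp (lpEmbedding q)
  mul_le' := norm_lpEmbedding_mul_le q

theorem hasGrowth_embeddingNorm :
    HasGrowth (embeddingNorm (K := K) q) (Module.finrank ℚ K) := by
  rw [← RingOfIntegers.rank, Module.finrank_eq_card_chooseBasisIndex]
  have hbasis : lpEmbedding q ∘ RingOfIntegers.basis K =
      (WithLp.linearEquiv (q : ENNReal) ℝ ((K →+* ℂ) → ℂ)).symm ∘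
        canonicalEmbedding.latticeBasis K := by
    ext i σ
    simp [lpEmbedding, canonicalEmbedding.latticeBasis_apply, integralBasis_apply]
  have hind : LinearIndependent ℝ (canonicalEmbedding.latticeBasis K) :=
    (canonicalEmbedding.latticeBasis K).linearIndependent.restrict_scalars
      (by simpa only [Complex.real_smul, mul_one] using Complex.ofReal_injective)
  refine hasGrowth_norm_of_linearIndependent (RingOfIntegers.basis K) (lpEmbedding q) ?_
  rw [hbasis]
  exact hind.map' _ (LinearEquiv.ker _)

variable {q}

theorem size_le_iff {N : ℝ} (hN : 0 ≤ N) (b : 𝓞 K) :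
    size q (b : K) ≤ N ↔ embeddingNorm q b ≤ (N ^ 2) ^ (q : ℝ)⁻¹ := by
  have hq : 0 < q := by exact_mod_cast (Fact.out : 1 ≤ (q : ENNReal))
  rw [size, Real.sqrt_le_left hN, ← norm_lpEmbedding_pow, Real.le_rpow_inv_iff_of_pos
    (apply_nonneg _ _) (by positivity) (by positivity), Real.rpow_natCast]
  rfl

theorem tendsto_sq_rpow_inv {q : ℕ} (hq : q ≠ 0) :
    Tendsto (fun N : ℝ => (N ^ 2) ^ (q : ℝ)⁻¹) atTop atTop :=
  (tendsto_rpow_atTop (by positivity)).comp (tendsto_pow_atTop two_ne_zero)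

theorem exists_proportion_affine_mem_le {c : 𝓞 K} (hc : c ≠ 0) (d : 𝓞 K) :
    ∃ C : ℝ, ∀ J : Ideal (𝓞 K), J ≠ ⊥ → ∀ R : ℝ, 1 ≤ R →
      proportion (embeddingNorm q) {b | c * b + d ∈ J ∧ c * b + d ≠ 0} R ≤
        C * (Ideal.absNorm J : ℝ)⁻¹ := by
  obtain ⟨C, hle⟩ := (hasGrowth_embeddingNorm q).exists_proportion_affine_le
    (σ := Ideal (𝓞 K)) (IsLeftCancelMulZero.mul_left_cancel_of_ne_zero hc) d
  refine ⟨C, fun J hJ R hR => ?_⟩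
  have hJ0 : 0 < (Ideal.absNorm J : ℝ) := by
    exact_mod_cast Nat.pos_of_ne_zero (mt Ideal.absNorm_eq_zero_iff.1 hJ)
  have hn : Module.finrank ℚ K ≠ 0 := Module.finrank_pos.ne'
  have hsep : ∀ x ∈ J, x ≠ 0 →
      (Ideal.absNorm J : ℝ) ^ (Module.finrank ℚ K : ℝ)⁻¹ ≤ embeddingNorm q x := fun x hx hx0 => by
    rw [Real.rpow_inv_le_iff_of_pos hJ0.le (apply_nonneg _ _) (by positivity), Real.rpow_natCast]
    exact absNorm_le_pow_of_mem hx hx0 fun σ => norm_apply_le_norm_lpEmbedding q σ x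
  have := hle J _ (by positivity) hsep R hR
  rwa [Real.rpow_inv_natCast_pow hJ0.le hn, div_eq_mul_inv] at this

end EmbeddingNorm

section LinearForms

variable {ι : Type*} [Fintype ι]

theorem ne_zero_of_squarefree_prod_linear {A : Type*} [CommRing A] [Nontrivial A] {c d : ι → A}
    (h : Squarefree (∏ i, (C (c i) * X + C (d i)))) {i : ι} (hc : c i = 0) : d i ≠ 0 := by
  intro hd
  exact h.ne_zero (Finset.prod_eq_zero (Finset.mem_univ i) (by simp [hc, hd]))

theorem mul_ne_mul_of_squarefree_prod_linear {F : Type*} [Field F] {c d : ι → F}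
    (h : Squarefree (∏ i, (C (c i) * X + C (d i)))) {i j : ι} (hij : i ≠ j) (hj : c j ≠ 0) :
    c i * d j ≠ c j * d i := by
  classical
  intro hres
  have hprop : C (c i) * X + C (d i) = C (c i / c j) * (C (c j) * X + C (d j)) := by
    rw [mul_add, ← mul_assoc, ← C_mul, ← C_mul, div_mul_cancel₀ _ hj, div_mul_eq_mul_div, hres,
      mul_div_cancel_left₀ _ hj]
  have hdvd : (C (c j) * X + C (d j)) * (C (c j) * X + C (d j)) ∣
      ∏ l, (C (c l) * X + C (d l)) := by
    refine .trans ?_ (Finset.prod_dvd_prod_of_subset {i, j} _ _ (Finset.subset_univ _))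
    rw [Finset.prod_pair hij, hprop, mul_assoc]
    exact dvd_mul_left _ _
  have hdeg := degree_eq_zero_of_isUnit (h _ hdvd)
  rw [degree_linear hj] at hdeg
  exact one_ne_zero hdeg

theorem exists_mem_pow_of_prod_mem_pow {A : Type*} [CommRing A] [IsDedekindDomain A]
    {P : Ideal A} [hP : P.IsPrime] {n : ℕ} (hn : n ≠ 0) {f : ι → A}
    (hf : Pairwise fun i j => f i ∈ P → f j ∉ P) (hprod : ∏ i, f i ∈ P ^ n) :
    ∃ i, f i ∈ P ^ n := by
  classical
  obtain ⟨i, -, hi⟩ := hP.prod_mem_iff.1 (Ideal.pow_le_self hn hprod)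
  rw [← Finset.mul_prod_erase _ _ (Finset.mem_univ i)] at hprod
  refine ⟨i, (hP.mem_pow_mul _ hprod).resolve_right fun hrest => ?_⟩
  obtain ⟨j, hj, hfj⟩ := hP.prod_mem_iff.1 hrest
  exact hf (Finset.ne_of_mem_erase hj).symm hi hfj

theorem finite_setOf_mem_asIdeal {A : Type*} [CommRing A] [IsDedekindDomain A] {z : A}
    (hz : z ≠ 0) : {p : HeightOneSpectrum A | z ∈ p.asIdeal}.Finite := by
  refine (Ideal.finite_factors (I := Ideal.span {z}) (by simpa using hz)).subset fun p hp => ?_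
  exact Ideal.dvd_span_singleton.2 hp

theorem finite_setOf_exists_prod_linear_mem_sq {A : Type*} [CommRing A] [IsDedekindDomain A]
    {c d : ι → A} (hconst : ∀ i, c i = 0 → d i ≠ 0)
    (hres : Pairwise fun i j => c j ≠ 0 → c i * d j ≠ c j * d i) :
    {p : HeightOneSpectrum A | ∃ b, ∏ i, (c i * b + d i) ∈ p.asIdeal ^ 2 ∧
      ∀ i, c i ≠ 0 → c i * b + d i ∉ p.asIdeal ^ 2}.Finite := by
  have hfin : ((⋃ i ∈ {i | c i = 0}, {p : HeightOneSpectrum A | d i ∈ p.asIdeal}) ∪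
      ⋃ ij ∈ {ij : ι × ι | ij.1 ≠ ij.2 ∧ c ij.2 ≠ 0},
        {p : HeightOneSpectrum A | c ij.1 * d ij.2 - c ij.2 * d ij.1 ∈ p.asIdeal}).Finite :=
    ((Set.toFinite _).biUnion fun i hi => finite_setOf_mem_asIdeal (hconst i hi)).union
      ((Set.toFinite _).biUnion fun ij h =>
        finite_setOf_mem_asIdeal (sub_ne_zero.2 (hres h.1 h.2)))
  refine hfin.subset fun p ⟨b, hprod, hb⟩ => ?_
  by_contra hp
  simp only [Set.mem_union, Set.mem_iUnion, Set.mem_ofPred_eq, not_or, not_exists] at hp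
  obtain ⟨hd, hcd⟩ := hp
  have hc : ∀ i, c i * b + d i ∈ p.asIdeal → c i ≠ 0 := fun i hi h0 =>
    hd i h0 (by simpa [h0] using hi)
  have hcoprime : Pairwise fun i j => c i * b + d i ∈ p.asIdeal → c j * b + d j ∉ p.asIdeal := by
    intro i j hij hi hj
    refine hcd (i, j) ⟨hij, hc j hj⟩ ?_
    convert p.asIdeal.sub_mem (p.asIdeal.mul_mem_left (c i) hj)
      (p.asIdeal.mul_mem_left (c j) hi) using 1
    ring
  obtain ⟨i, hi⟩ := exists_mem_pow_of_prod_mem_pow two_ne_zero hcoprime hprod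
  exact hb i (hc i (Ideal.pow_le_self two_ne_zero hi)) hi

end LinearForms

theorem tprod_pos_of_summable_sub_one {ι : Type*} {f : ι → ℝ} (hpos : ∀ i, 0 < f i)
    (hsum : Summable fun i => f i - 1) : 0 < ∏' i, f i := by
  have hlog : Summable fun i => Real.log (f i) := by
    simpa using Real.summable_log_one_add_of_summable hsum
  rw [← Real.rexp_tsum_eq_tprod hpos hlog]
  exact Real.exp_pos _

theorem eval_map_mk_ne_zero_iff {A : Type*} [CommRing A] {I : Ideal A} {f : A[X]} {b : A} :
    (f.map (Ideal.Quotient.mk I)).eval (Ideal.Quotient.mk I b) ≠ 0 ↔ f.eval b ∉ I := by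
  rw [Polynomial.eval_map_apply, ne_eq, Ideal.Quotient.eq_zero_iff_mem]

section LocalConditions

variable {K : Type*} [Field K] {S : Finset (HeightOneSpectrum (𝓞 K))} {T : Set (𝓞 K)}

theorem localDensity_eq_ncard_div (A : (𝓞 K)[X]) (p : HeightOneSpectrum (𝓞 K)) :
    localDensity A p = {x | (A.map (Ideal.Quotient.mk (p.asIdeal ^ 2))).eval x ≠ 0}.ncard /
      Nat.card (𝓞 K ⧸ p.asIdeal ^ 2) := by
  rw [localDensity, ← Nat.card_coe_set_eq]
  rfl

variable [NumberField K]

theorem squarefreeAway_iff {a : 𝓞 K} :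
    SquarefreeAway S a ↔ ∀ p : {p // p ∉ S}, a ∉ p.1.asIdeal ^ 2 := by
  simp [SquarefreeAway, Ideal.dvd_span_singleton]

theorem DefinedByCongruencesAt.exists_eq_preimage (hT : DefinedByCongruencesAt S T) :
    ∃ I : Ideal (𝓞 K), I ≠ ⊥ ∧ (∀ p ∉ S, ∀ m, IsCoprime I (p.asIdeal ^ m)) ∧
      ∃ Y : Set (𝓞 K ⧸ I), T = Ideal.Quotient.mk I ⁻¹' Y := by
  obtain ⟨e, he⟩ := hT
  refine ⟨∏ p ∈ S, p.asIdeal ^ e p, Finset.prod_ne_zero_iff.2 fun p _ => pow_ne_zero _ p.ne_bot,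
    fun p hp m => IsCoprime.prod_left fun p' hp' =>
      p'.isCoprime_pow_of_ne p (ne_of_mem_of_not_mem hp' hp) _ _,
    Ideal.Quotient.mk _ '' T, (Set.subset_preimage_image _ _).antisymm ?_⟩
  rintro b ⟨b', hb', hbb'⟩
  refine (he b' b fun p hp => ?_).1 hb'
  exact Ideal.le_of_dvd (Finset.dvd_prod_of_mem _ hp) (Ideal.Quotient.eq.1 hbb')

theorem finite_quotient_pow (p : HeightOneSpectrum (𝓞 K)) (m : ℕ) :
    Finite (𝓞 K ⧸ p.asIdeal ^ m) :=
  Ideal.finiteQuotientOfFreeOfNeBot _ (pow_ne_zero _ p.ne_bot)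

variable {F : Type*} [FunLike F (𝓞 K) ℝ] [AddGroupSeminormClass F (𝓞 K) ℝ] {ν : F} {n : ℕ}

theorem HasGrowth.hasDensity_eval_mem_sq (hν : HasGrowth ν n) (A : (𝓞 K)[X])
    (p : HeightOneSpectrum (𝓞 K)) :
    HasDensity ν {b | A.eval b ∈ p.asIdeal ^ 2} (1 - localDensity A p) := by
  have := finite_quotient_pow p 2
  rw [localDensity_eq_ncard_div]
  let f := (Ideal.Quotient.mk (p.asIdeal ^ 2)).toAddMonoidHom
  convert hν.hasDensity_compl (hν.hasDensity_preimage (f := f) Ideal.Quotient.mk_surjective _)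
    using 1
  ext b
  exact iff_not_comm.1 eval_map_mk_ne_zero_iff

theorem HasGrowth.exists_hasDensity_forall_eval_notMem_sq (hν : HasGrowth ν n)
    (hT : DefinedByCongruencesAt S T) (hTne : T.Nonempty) (A : (𝓞 K)[X]) :
    ∃ δ : ℝ, 0 < δ ∧ ∀ P : Finset {p // p ∉ S},
      HasDensity ν {b | b ∈ T ∧ ∀ p ∈ P, A.eval b ∉ p.1.asIdeal ^ 2}
        (δ * ∏ p ∈ P, localDensity A p.1) := by
  obtain ⟨I, hI, hIS, Y, rfl⟩ := hT.exists_eq_preimage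
  have := Ideal.finiteQuotientOfFreeOfNeBot I hI
  have hY : 0 < Y.ncard := Set.ncard_pos (Set.toFinite Y) |>.2 (hTne.elim fun b hb => ⟨_, hb⟩)
  refine ⟨Y.ncard / Nat.card (𝓞 K ⧸ I),
    div_pos (by exact_mod_cast hY) (by exact_mod_cast Nat.card_pos), fun P => ?_⟩
  have hfin := fun p : P => finite_quotient_pow p.1.1 2
  have hcoprime : Pairwise (Function.onFun IsCoprime fun p : P => p.1.1.asIdeal ^ 2) :=
    fun p p' hpp' => p.1.1.isCoprime_pow_of_ne _
      (fun h => hpp' (Subtype.ext (Subtype.ext h))) _ _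
  have hdensity := hν.hasDensity_mk_mem_and_forall_mk_mem (fun p : P => hIS _ p.1.2 2) hcoprime Y
    fun p => {x | (A.map (Ideal.Quotient.mk (p.1.1.asIdeal ^ 2))).eval x ≠ 0}
  simp only [← localDensity_eq_ncard_div] at hdensity
  rw [Finset.prod_coe_sort P fun p => localDensity A p.1] at hdensity
  simpa only [Set.mem_preimage, Set.mem_ofPred_eq, eval_map_mk_ne_zero_iff, Subtype.forall]
    using hdensity

end LocalConditions

section ProdLinear

variable {K : Type*} [Field K] {k : ℕ} {c d : Fin k → 𝓞 K}

theorem eval_prodLinear (b : 𝓞 K) : (prodLinear c d).eval b = ∏ i, (c i * b + d i) := by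
  simp [prodLinear, eval_prod]

variable [NumberField K]

theorem finite_setOf_exists_eval_prodLinear_mem_sq
    (hA : Squarefree ((prodLinear c d).map (algebraMap (𝓞 K) K))) :
    {p : HeightOneSpectrum (𝓞 K) | ∃ b, (prodLinear c d).eval b ∈ p.asIdeal ^ 2 ∧
      ∀ i, c i ≠ 0 → c i * b + d i ∉ p.asIdeal ^ 2}.Finite := by
  have hA' : Squarefree (∏ i, (C (c i : K) * X + C (d i : K))) := by
    simpa [prodLinear, Polynomial.map_prod] using hA
  simp only [eval_prodLinear]
  refine finite_setOf_exists_prod_linear_mem_sq (fun i hi => ?_) fun i j hij hj => ?_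
  · exact_mod_cast ne_zero_of_squarefree_prod_linear hA' (i := i) (by exact_mod_cast hi)
  · exact_mod_cast mul_ne_mul_of_squarefree_prod_linear hA' hij (by exact_mod_cast hj)

theorem exists_proportion_eval_prodLinear_mem_sq_le (q : ℕ) [Fact (1 ≤ (q : ENNReal))]
    (hA : Squarefree ((prodLinear c d).map (algebraMap (𝓞 K) K))) :
    ∃ (Z : Set (𝓞 K)) (P₀ : Finset (HeightOneSpectrum (𝓞 K))) (u : HeightOneSpectrum (𝓞 K) → ℝ),
      Z.Finite ∧ Summable u ∧ ∀ R, 1 ≤ R → ∀ p ∉ P₀,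
        proportion (embeddingNorm q)
          ({b | (prodLinear c d).eval b ∈ p.asIdeal ^ 2} \ Z) R ≤ u p := by
  classical
  have := (hasGrowth_embeddingNorm (K := K) q).northcott
  choose C hC using fun i : {i // c i ≠ 0} => exists_proportion_affine_mem_le (q := q) i.2 (d i)
  refine ⟨⋃ i : {i // c i ≠ 0}, {b | c i * b + d i = 0},
    (finite_setOf_exists_eval_prodLinear_mem_sq hA).toFinset,
    fun p => ∑ i, C i * ((Ideal.absNorm p.asIdeal : ℝ) ^ 2)⁻¹, ?_, ?_, fun R hR p hp => ?_⟩
  · refine Set.finite_iUnion fun i => Set.Subsingleton.finite fun b hb b' hb' => ?_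
    exact mul_left_cancel₀ i.2 (add_right_cancel (hb.trans hb'.symm))
  · exact summable_sum fun i _ => (summable_absNorm_inv_sq (R := 𝓞 K)).mul_left (C i)
  · refine le_trans (proportion_mono ?_ R) ((proportion_iUnion_le_tsum .of_finite fun i =>
      hC i (p.asIdeal ^ 2) (pow_ne_zero _ p.ne_bot) R hR).trans ?_)
    · rintro b ⟨hb, hbZ⟩
      simp only [Set.Finite.mem_toFinset, Set.mem_ofPred_eq, not_exists, not_and, not_forall,
        not_not] at hp
      obtain ⟨i, hi, hmem⟩ := hp b hb
      exact Set.mem_iUnion.2 ⟨⟨i, hi⟩, hmem, fun h0 => hbZ (Set.mem_iUnion.2 ⟨⟨i, hi⟩, h0⟩)⟩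
    · simp [tsum_fintype]

theorem summable_localDensity_prodLinear_sub_one
    (hA : Squarefree ((prodLinear c d).map (algebraMap (𝓞 K) K))) :
    Summable fun p : HeightOneSpectrum (𝓞 K) => localDensity (prodLinear c d) p - 1 := by
  have : Fact (1 ≤ ((1 : ℕ) : ENNReal)) := ⟨by simp⟩
  have hν := hasGrowth_embeddingNorm (K := K) 1
  have := hν.northcott
  obtain ⟨Z, P₀, u, hZ, hu, hle⟩ := exists_proportion_eval_prodLinear_mem_sq_le 1 hA
  refine hu.of_norm_bounded_eventually ?_
  filter_upwards [P₀.finite_toSet.compl_mem_cofinite] with p hp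
  have hmem := hν.hasDensity_eval_mem_sq (prodLinear c d) p
  rw [norm_sub_rev, Real.norm_of_nonneg hmem.nonneg]
  refine hmem.le_of_proportion_sdiff_le (hν.hasDensity_of_finite Module.finrank_pos.ne' hZ) ?_
  filter_upwards [eventually_ge_atTop 1] with R hR
  exact hle R hR p hp

theorem multipliable_localDensity_prodLinear (S : Finset (HeightOneSpectrum (𝓞 K)))
    (hA : Squarefree ((prodLinear c d).map (algebraMap (𝓞 K) K))) :
    Multipliable fun p : {p // p ∉ S} => localDensity (prodLinear c d) p.1 := by
  have hsum := (summable_localDensity_prodLinear_sub_one hA).comp_injective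
    (Subtype.val_injective (p := (· ∉ S)))
  simpa using multipliable_one_add_of_summable hsum.norm

theorem exists_hasDensity_squarefreeAway_prodLinear (q : ℕ) [Fact (1 ≤ (q : ENNReal))]
    {S : Finset (HeightOneSpectrum (𝓞 K))} {T : Set (𝓞 K)} (hT : DefinedByCongruencesAt S T)
    (hTne : T.Nonempty) (hA : Squarefree ((prodLinear c d).map (algebraMap (𝓞 K) K))) :
    ∃ δ : ℝ, 0 < δ ∧ HasDensity (embeddingNorm q) T δ ∧
      HasDensity (embeddingNorm q) {b | b ∈ T ∧ SquarefreeAway S ((prodLinear c d).eval b)}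
        (δ * ∏' p : {p // p ∉ S}, localDensity (prodLinear c d) p.1) := by
  classical
  have hν := hasGrowth_embeddingNorm (K := K) q
  have := hν.northcott
  obtain ⟨δ, hδ, hfin⟩ := hν.exists_hasDensity_forall_eval_notMem_sq hT hTne (prodLinear c d)
  refine ⟨δ, hδ, by simpa using hfin ∅, ?_⟩
  obtain ⟨Z, P₀, u, hZ, hu, hle⟩ := exists_proportion_eval_prodLinear_mem_sq_le q hA
  simp only [squarefreeAway_iff]
  refine hasDensity_forall_notMem (P₀ := P₀.subtype (· ∉ S)) hfin
    ((multipliable_localDensity_prodLinear S hA).hasProd.const_mul δ)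
    (hν.hasDensity_of_finite Module.finrank_pos.ne' hZ) (hu.subtype {p | p ∉ S}) ?_
  filter_upwards [eventually_ge_atTop 1] with R hR p hp
  exact hle R hR p.1 (by simpa using hp)

theorem tendsto_ncard_squarefreeAway_div_ncard {q : ℕ} (hq : q ≠ 0)
    {S : Finset (HeightOneSpectrum (𝓞 K))} {T : Set (𝓞 K)} (hT : DefinedByCongruencesAt S T)
    (hTne : T.Nonempty) (hA : Squarefree ((prodLinear c d).map (algebraMap (𝓞 K) K))) :
    Tendsto (fun N : ℝ =>
        (Set.ncard {b : 𝓞 K | b ∈ T ∧ size q (b : K) ≤ N ∧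
          SquarefreeAway S ((prodLinear c d).eval b)} : ℝ) /
        (Set.ncard {b : 𝓞 K | b ∈ T ∧ size q (b : K) ≤ N} : ℝ))
      atTop (𝓝 (∏' p : {p // p ∉ S}, localDensity (prodLinear c d) p.1)) := by
  have : Fact (1 ≤ (q : ENNReal)) := ⟨by exact_mod_cast Nat.one_le_iff_ne_zero.2 hq⟩
  obtain ⟨δ, hδ, hTδ, hsq⟩ := exists_hasDensity_squarefreeAway_prodLinear q hT hTne hA
  have hratio := ((hasGrowth_embeddingNorm q).tendsto_ncard_div_ncard hsq hTδ hδ.ne').comp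
    (tendsto_sq_rpow_inv hq)
  rw [mul_div_cancel_left₀ _ hδ.ne'] at hratio
  refine hratio.congr' ?_
  filter_upwards [eventually_ge_atTop 0] with N hN
  simp only [size_le_iff hN, Function.comp_apply]
  congr 3
  ext b
  exact and_right_comm.trans and_assoc

end ProdLinear

end SquarefreeSieve

end

theorem mainTheorem5_general {K : Type*} [Field K] [NumberField K]
    (S : Finset (HeightOneSpectrum (𝓞 K))) (T : Set (𝓞 K))
    (hT : SquarefreeSieve.DefinedByCongruencesAt S T) (hTne : T.Nonempty)
    {k : ℕ} (c d : Fin k → 𝓞 K)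
    (hA : Squarefree ((SquarefreeSieve.prodLinear c d).map (algebraMap (𝓞 K) K)))
    (q : ℕ) (hq : q ≠ 0) :
    Multipliable (fun p : {p : HeightOneSpectrum (𝓞 K) // p ∉ S} =>
        SquarefreeSieve.localDensity (SquarefreeSieve.prodLinear c d) p.1) ∧
    Tendsto (fun N : ℝ =>
        (Set.ncard {b : 𝓞 K | b ∈ T ∧ SquarefreeSieve.size q (b : K) ≤ N ∧
          SquarefreeSieve.SquarefreeAway S ((SquarefreeSieve.prodLinear c d).eval b)} : ℝ) /
        (Set.ncard {b : 𝓞 K | b ∈ T ∧ SquarefreeSieve.size q (b : K) ≤ N} : ℝ))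
      atTop
      (𝓝 (∏' p : {p : HeightOneSpectrum (𝓞 K) // p ∉ S},
        SquarefreeSieve.localDensity (SquarefreeSieve.prodLinear c d) p.1)) ∧
    ((∀ p : HeightOneSpectrum (𝓞 K), p ∉ S →
        0 < SquarefreeSieve.localDensity (SquarefreeSieve.prodLinear c d) p) →
      0 < ∏' p : {p : HeightOneSpectrum (𝓞 K) // p ∉ S},
        SquarefreeSieve.localDensity (SquarefreeSieve.prodLinear c d) p.1) := by
  refine ⟨SquarefreeSieve.multipliable_localDensity_prodLinear S hA,
    SquarefreeSieve.tendsto_ncard_squarefreeAway_div_ncard hq hT hTne hA, fun hpos => ?_⟩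
  have hsum := SquarefreeSieve.summable_localDensity_prodLinear_sub_one hA
  exact SquarefreeSieve.tprod_pos_of_summable_sub_one (fun p => hpos p.1 p.2)
    (hsum.subtype {p | p ∉ S})

theorem mainTheorem5 {K : Type*} [Field K] [NumberField K]
    (S : Finset (HeightOneSpectrum (𝓞 K))) (T : Set (𝓞 K))
    (hT : SquarefreeSieve.DefinedByCongruencesAt S T) (hTne : T.Nonempty)
    {k : ℕ} (c d : Fin k → 𝓞 K)
    (hA : Squarefree ((SquarefreeSieve.prodLinear c d).map (algebraMap (𝓞 K) K)))
    (q : ℕ) (hq : q = 1 ∨ q = 2) :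
    Multipliable (fun p : {p : HeightOneSpectrum (𝓞 K) // p ∉ S} =>
        SquarefreeSieve.localDensity (SquarefreeSieve.prodLinear c d) p.1) ∧
    Tendsto (fun N : ℝ =>
        (Set.ncard {b : 𝓞 K | b ∈ T ∧ SquarefreeSieve.size q (b : K) ≤ N ∧
          SquarefreeSieve.SquarefreeAway S ((SquarefreeSieve.prodLinear c d).eval b)} : ℝ) /
        (Set.ncard {b : 𝓞 K | b ∈ T ∧ SquarefreeSieve.size q (b : K) ≤ N} : ℝ))
      atTop
      (𝓝 (∏' p : {p : HeightOneSpectrum (𝓞 K) // p ∉ S},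
        SquarefreeSieve.localDensity (SquarefreeSieve.prodLinear c d) p.1)) ∧
    ((∀ p : HeightOneSpectrum (𝓞 K), p ∉ S →
        0 < SquarefreeSieve.localDensity (SquarefreeSieve.prodLinear c d) p) →
      0 < ∏' p : {p : HeightOneSpectrum (𝓞 K) // p ∉ S},
        SquarefreeSieve.localDensity (SquarefreeSieve.prodLinear c d) p.1) :=
  mainTheorem5_general S T hT hTne c d hA q (by rcases hq with rfl | rfl <;> norm_num)
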